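/- Let $E=(E,\mathscr T,\le)$ be a completely regularly ordered space: $\le$ is a partial order on the topological space $(E,\mathscr T)$, the topology $\mathscr T$ is the initial topology generated by the set $\mathcal F$ of continuous isotone functions $f:E\to[0,1]$, and $x\le y$ if and only if $f(x)\le f(y)$ for every $f\in\mathcal F$. Let $\beta:E\to\beta E$ be the Stone–Čech compactification, endowed with the preorder $$z\le_\beta w \iff \tilde f(z)\le\tilde f(w)\ \text{ for every } f\in\mathcal F,$$ where $\tilde f:\beta E\to[0,1]$ is the continuous extension of $f$. Let $z\sim_\beta w$ mean $z\le_\beta w$ and $w\le_\beta z$, and let $\Pi:\beta E\to\beta E/{\sim_\beta}$ be the quotient projection, where $\beta E/{\sim_\beta}$ carries the quotient topology and the quotient order. Let $n:E\to nE$ be Nachbin's compactification: $n(x)=(f(x))_{f\in\mathcal F}$, and $nE$ is the closure of the image of $E$ in $[0,1]^{\mathcal F}$, with the topology and order induced by the product topology and the product order. A $T_2$-order compactification of $E$ is a map $c:E\to cE$ into a compact topological space with a partial order that is closed in $cE\times cE$, such that $c(E)$ is dense in $cE$ and $c$ is a homeomorphism onto its image satisfying $c(x)\le c(y)\iff x\le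 y$. Two such compactifications $c_1,c_2$ are equivalent if there are continuous isotone maps $C:c_2E\to c_1E$ and $D:c_1E\to c_2E$ with $C\circ c_2=c_1$ and $D\circ c_1=c_2$. Then $\Pi\circ\beta:E\to\beta E/{\sim_\beta}$ and $n:E\to nE$ are $T_2$-order compactifications of $E$, and they are equivalent. -/

import Mathlib

noncomputable section

namespace OrdCompact

open Topology

/-- A topological preordered space is completely regularly preordered if its topology is the
initial topology of the continuous isotone functions `E → [0,1]`, and if its preorder is
represented by these functions. A completely regularly ordered space is such a space whose
preorder is a partial order. -/
structure IsCompletelyRegularlyPreordered (E : Type*) [t : TopologicalSpace E] [Preorder E] :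
    Prop where
  topology_eq : t = ⨅ f : ContinuousOrderHom E unitInterval, TopologicalSpace.induced f inferInstance
  le_iff : ∀ x y : E, x ≤ y ↔ ∀ f : ContinuousOrderHom E unitInterval, f x ≤ f y

/-- A preorder embedding: a homeomorphism onto the image (with the induced topology) which
preserves and reflects the preorder. -/
structure IsPreorderEmbedding {E X : Type*} [TopologicalSpace E] [Preorder E]
    [TopologicalSpace X] [Preorder X] (c : E → X) : Prop where
  isEmbedding : IsEmbedding c
  le_iff : ∀ x y : E, c x ≤ c y ↔ x ≤ y

/-- A preorder compactification: a preorder embedding with dense image in a compact space. -/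
structure IsPreorderCompactification {E X : Type*} [TopologicalSpace E] [Preorder E]
    [TopologicalSpace X] [Preorder X] (c : E → X) : Prop where
  compactSpace : CompactSpace X
  isPreorderEmbedding : IsPreorderEmbedding c
  denseRange : DenseRange c

/-- A `T₂`-order compactification: a preorder compactification whose target is ordered
(antisymmetric), with an order that is closed in the product topology. -/
structure IsT2OrderCompactification {E X : Type*} [TopologicalSpace E] [Preorder E]
    [TopologicalSpace X] [PartialOrder X] (c : E → X) : Prop where
  isPreorderCompactification : IsPreorderCompactification c
  orderClosedTopology : OrderClosedTopology X

/-- `Dominates c₂ c₁` means `c₁ ≤ c₂`: the map `c₁` factors through `c₂` by a continuous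
isotone map. -/
def Dominates {E X₁ X₂ : Type*} [TopologicalSpace X₁] [Preorder X₁]
    [TopologicalSpace X₂] [Preorder X₂] (c₂ : E → X₂) (c₁ : E → X₁) : Prop :=
  ∃ C : X₂ → X₁, Continuous C ∧ Monotone C ∧ C ∘ c₂ = c₁

/-- Equivalence of compactifications: each dominates the other. -/
def Equivalent {E X₁ X₂ : Type*} [TopologicalSpace X₁] [Preorder X₁]
    [TopologicalSpace X₂] [Preorder X₂] (c₁ : E → X₁) (c₂ : E → X₂) : Prop :=
  Dominates c₂ c₁ ∧ Dominates c₁ c₂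

section Beta

variable (E : Type*) [TopologicalSpace E] [Preorder E]

/-- The preorder `≤_β` on the Stone-Čech compactification: `z ≤_β w` if and only if
`f̃ z ≤ f̃ w` for the continuous extension `f̃` of every continuous isotone `f : E → [0,1]`. -/
instance instPreorderStoneCech : Preorder (StoneCech E) where
  le z w := ∀ f : ContinuousOrderHom E unitInterval,
    stoneCechExtend (map_continuous f) z ≤ stoneCechExtend (map_continuous f) w
  le_refl _ _ := le_rfl
  le_trans _ _ _ h₁ h₂ f := (h₁ f).trans (h₂ f)

end Beta

section Quotient

variable (X : Type*) [TopologicalSpace X] [Preorder X]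

/-- The quotient topology on `X/∼`, where `x ∼ y` means `x ≤ y` and `y ≤ x`. The quotient order
on `X/∼` is Mathlib's instance. -/
instance instTopologicalSpaceAntisymmetrization :
    TopologicalSpace (Antisymmetrization X (· ≤ ·)) :=
  inferInstanceAs (TopologicalSpace (Quotient (AntisymmRel.setoid X (· ≤ ·))))

end Quotient

section Maps

variable (E : Type*) [TopologicalSpace E] [Preorder E]

/-- The space `βE/∼_β`. -/
abbrev BetaQuotient := Antisymmetrization (StoneCech E) (· ≤ ·)

/-- The map `Π ∘ β : E → βE/∼_β`. -/
def betaQuotientMap : E → BetaQuotient E :=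
  toAntisymmetrization (· ≤ ·) ∘ stoneCechUnit

/-- The evaluation map of `E` into the cube indexed by the continuous isotone functions
`E → [0,1]`. -/
def isotoneEval : E → (ContinuousOrderHom E unitInterval → unitInterval) :=
  fun x f => f x

/-- Nachbin's space `nE`: the closure of the image of `E` in the cube, with the topology and the
order induced by the product topology and the product order. -/
abbrev NachbinSpace := closure (Set.range (isotoneEval E))

/-- Nachbin's map `n : E → nE`. -/
def nachbinMap : E → NachbinSpace E :=
  fun x => ⟨isotoneEval E x, subset_closure (Set.mem_range_self x)⟩

end Maps

end OrdCompact

end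

/-!
The continuous extensions of the continuous isotone functions `f : E → [0,1]` assemble into a
continuous map `βE → [0,1]^𝓕`. As `βE` is compact and `E` is dense in it, the image of this map is
exactly the closure `nE` of the image of `E`. By the definition of `≤_β` the map reflects and
preserves the preorder, so it descends to an order isomorphism `βE/∼_β ≃ nE`
(`OrdCompact.betaQuotientOrderIso`), which is continuous from a compact space to a Hausdorff one
and hence a homeomorphism (`OrdCompact.betaQuotientHomeomorph`). It carries `Π ∘ β` to `n`.

Complete regularity of `E` says precisely that `n` is a homeomorphism and an order embedding onto
its image, while `nE` inherits compactness and the closed order from the cube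
(`OrdCompact.isT2OrderCompactification_nachbinMap`). The isomorphism transports these properties
to `βE/∼_β`, and together with its inverse it witnesses the equivalence.
-/

namespace OrdCompact

open Topology

section Transport

variable {E X Y : Type*} [TopologicalSpace E] [Preorder E] [TopologicalSpace X] [PartialOrder X]
  [TopologicalSpace Y] [PartialOrder Y]

/-- A `T₂`-order compactification can be transported backwards along a homeomorphism that is an
order isomorphism. -/
theorem IsT2OrderCompactification.of_homeomorph {c : E → X} {d : E → Y}
    (hd : IsT2OrderCompactification d) (φ : X ≃ₜ Y) (hφ : ∀ x y, φ x ≤ φ y ↔ x ≤ y)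
    (hcd : φ ∘ c = d) : IsT2OrderCompactification c := by
  subst hcd
  have hc := hd.isPreorderCompactification
  have := hc.compactSpace
  have := hd.orderClosedTopology
  refine ⟨⟨φ.symm.compactSpace, ⟨?_, fun x y => ?_⟩, ?_⟩, ⟨?_⟩⟩
  · exact φ.isEmbedding.of_comp_iff.mp hc.isPreorderEmbedding.isEmbedding
  · rw [← hφ]
    exact hc.isPreorderEmbedding.le_iff x y
  · simpa [Function.comp_def] using φ.symm.surjective.denseRange.comp hc.denseRange φ.symm.continuous
  · simp only [← hφ]
    exact isClosed_le (φ.continuous.comp continuous_fst) (φ.continuous.comp continuous_snd)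

end Transport

section Nachbin

variable {E : Type*} [TopologicalSpace E]

theorem continuous_isotoneEval [Preorder E] : Continuous (isotoneEval E) :=
  continuous_pi fun f => map_continuous f

theorem isEmbedding_isotoneEval [PartialOrder E] (hE : IsCompletelyRegularlyPreordered E) :
    IsEmbedding (isotoneEval E) := by
  refine ⟨⟨?_⟩, fun x y hxy => ?_⟩
  · rw [Pi.topologicalSpace, induced_iInf]
    simp only [induced_compose]
    exact hE.topology_eq
  · exact le_antisymm ((hE.le_iff x y).2 fun f => (congrFun hxy f).le)
      ((hE.le_iff y x).2 fun f => (congrFun hxy f).ge)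

theorem isT2OrderCompactification_nachbinMap [PartialOrder E]
    (hE : IsCompletelyRegularlyPreordered E) :
    IsT2OrderCompactification (nachbinMap E) := by
  refine ⟨⟨isCompact_iff_compactSpace.mp isClosed_closure.isCompact,
    ⟨(isEmbedding_isotoneEval hE).codRestrict _ _, fun x y => (hE.le_iff x y).symm⟩, ?_⟩,
    inferInstance⟩
  rw [DenseRange, Subtype.dense_iff]
  refine closure_mono ?_
  rintro _ ⟨x, rfl⟩
  exact ⟨nachbinMap E x, ⟨x, rfl⟩, rfl⟩

end Nachbin

section Beta

variable (E : Type*) [TopologicalSpace E] [Preorder E]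

/-- The map `βE → [0,1]^𝓕` whose coordinates are the continuous extensions of the continuous
isotone functions `f : E → [0,1]`. -/
noncomputable def stoneCechEval (z : StoneCech E) (f : ContinuousOrderHom E unitInterval) :
    unitInterval :=
  stoneCechExtend (map_continuous f) z

theorem continuous_stoneCechEval : Continuous (stoneCechEval E) :=
  continuous_pi fun f => continuous_stoneCechExtend (map_continuous f)

theorem stoneCechEval_comp_stoneCechUnit : stoneCechEval E ∘ stoneCechUnit = isotoneEval E := by
  funext x f
  exact congrFun (stoneCechExtend_extends (map_continuous f)) x

theorem range_stoneCechEval :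
    Set.range (stoneCechEval E) = closure (Set.range (isotoneEval E)) := by
  rw [← stoneCechEval_comp_stoneCechUnit]
  refine subset_antisymm ?_ ?_
  · rw [Set.range_comp]
    exact (continuous_stoneCechEval E).range_subset_closure_image_dense denseRange_stoneCechUnit
  · exact closure_minimal (Set.range_comp_subset_range _ _)
      (isCompact_range (continuous_stoneCechEval E)).isClosed

/-- The map `βE → nE` given by the extended isotone functions, as a monotone map. -/
noncomputable def stoneCechToNachbin : StoneCech E →o NachbinSpace E where
  toFun z := ⟨stoneCechEval E z, (range_stoneCechEval E).subset (Set.mem_range_self z)⟩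
  monotone' _ _ h := h

theorem stoneCechToNachbin_le_iff {z w : StoneCech E} :
    stoneCechToNachbin E z ≤ stoneCechToNachbin E w ↔ z ≤ w :=
  Iff.rfl

/-- The order isomorphism `βE/∼_β ≃ nE` induced by the extended isotone functions. -/
noncomputable def betaQuotientOrderIso : BetaQuotient E ≃o NachbinSpace E :=
  RelIso.ofSurjective
    (OrderEmbedding.ofMapLEIff
      (Quotient.lift (stoneCechToNachbin E) fun _ _ h =>
        le_antisymm ((stoneCechToNachbin E).monotone h.1) ((stoneCechToNachbin E).monotone h.2))
      (by
        rintro ⟨z⟩ ⟨w⟩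
        exact stoneCechToNachbin_le_iff E))
    (by
      rintro ⟨p, hp⟩
      obtain ⟨z, rfl⟩ := (range_stoneCechEval E).superset hp
      exact ⟨toAntisymmetrization (· ≤ ·) z, rfl⟩)

theorem continuous_betaQuotientOrderIso : Continuous (betaQuotientOrderIso E) :=
  Continuous.quotient_lift ((continuous_stoneCechEval E).subtype_mk _) _

/-- The order isomorphism `βE/∼_β ≃ nE` as a homeomorphism: a continuous bijection from a compact
space to a Hausdorff space. -/
noncomputable def betaQuotientHomeomorph : BetaQuotient E ≃ₜ NachbinSpace E :=
  have : CompactSpace (BetaQuotient E) :=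
    inferInstanceAs (CompactSpace (Quotient (AntisymmRel.setoid (StoneCech E) (· ≤ ·))))
  (continuous_betaQuotientOrderIso E).homeoOfEquivCompactToT2
    (f := (betaQuotientOrderIso E).toEquiv)

theorem betaQuotientHomeomorph_comp_betaQuotientMap :
    betaQuotientHomeomorph E ∘ betaQuotientMap E = nachbinMap E := by
  funext x
  exact Subtype.ext (congrFun (stoneCechEval_comp_stoneCechUnit E) x)

theorem equivalent_betaQuotientMap_nachbinMap :
    Equivalent (betaQuotientMap E) (nachbinMap E) := by
  have h := betaQuotientHomeomorph_comp_betaQuotientMap E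
  refine ⟨⟨(betaQuotientHomeomorph E).symm, (betaQuotientHomeomorph E).symm.continuous,
    (betaQuotientOrderIso E).symm.monotone, ?_⟩,
    ⟨betaQuotientHomeomorph E, (betaQuotientHomeomorph E).continuous,
      (betaQuotientOrderIso E).monotone, h⟩⟩
  rw [← h]
  funext x
  exact (betaQuotientHomeomorph E).symm_apply_apply _

end Beta

end OrdCompact

theorem mainTheorem6 {E : Type*} [TopologicalSpace E] [PartialOrder E]
    (hE : OrdCompact.IsCompletelyRegularlyPreordered E) :
    OrdCompact.IsT2OrderCompactification (OrdCompact.betaQuotientMap E) ∧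
      OrdCompact.IsT2OrderCompactification (OrdCompact.nachbinMap E) ∧
      OrdCompact.Equivalent (OrdCompact.betaQuotientMap E) (OrdCompact.nachbinMap E) := by
  have hn := OrdCompact.isT2OrderCompactification_nachbinMap hE
  exact ⟨hn.of_homeomorph (OrdCompact.betaQuotientHomeomorph E)
      (fun _ _ => (OrdCompact.betaQuotientOrderIso E).le_iff_le)
      (OrdCompact.betaQuotientHomeomorph_comp_betaQuotientMap E),
    hn, OrdCompact.equivalent_betaQuotientMap_nachbinMap E⟩
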